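/- Let $d\ge 2$, $p\ge 0$, $m,n\ge 1$, $N=m+n$, $\delta\ge 0$, and let $\mathcal H_E$ be a complex Hilbert space. Notation. $\mathcal A_d=\mathbb Z/d$, and $w(x)$ is the fraction of nonzero characters of a word $x$. A joint word $q=(q^0,\dots,q^p)$ consists of $p+1$ strings in $\mathcal A_d$ of equal length (Alice is party $0$, the Bobs are parties $1,\dots,p$). Its sum string $s(q)$ has $i$-th character $q^0_i+\dots+q^p_i \bmod d$. For a set $t$ of positions, $q_t$ and $q_{-t}$ are the joint words restricted to $t$ and to its complement. $\{|k\rangle\}$ is the computational ($Z$) basis, $|j\rangle^{\mathcal F}=d^{-1/2}\sum_k e^{2\pi i jk/d}|k\rangle$ the Fourier basis of $\mathbb C^d$, and $|q\rangle$, $|q\rangle^{\mathcal F}$ are the corresponding product vectors. For $0\le x\le 1$ let $H_d(x)=x\log_d(d-1)-x\log_d x-(1-x)\log_d(1-x)$ (with $0\log_d 0=0$). For a density operator $\rho_{AE}$, let $H_\infty(A|E)_\rho=\sup\{\lambda\in\mathbb R: 2^{-\lambda}I_A\otimes\sigma_E-\rho_{AE}\ge 0\text{ for some density operator }\sigma_E\}$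 and let $H_\infty(A_Z|E)_\rho$ be the min-entropy of the state obtained from $\rho$ by measuring $A$ in the $Z$ basis. Let $t\subset\{1,\dots,N\}$ have size $m$, and let $|\phi^t\rangle$ be a unit vector in $$\mathrm{span}\{|q\rangle^{\mathcal F}: q\in\mathcal A_d^{(p+1)N},\ |w(s(q_t))-w(s(q_{-t}))|\le\delta\}\otimes\mathcal H_E .$$ Measure the systems at the positions in $t$ in the Fourier basis, let $q\in\mathcal A_d^{(p+1)m}$ be an outcome of nonzero probability, and let $|\phi^t_q\rangle$ be the normalized post-measurement state of the remaining systems and $E$. Assume $w(s(q))+\delta\le 1-\frac1d$. Then $|\phi^t_q\rangle\in\mathrm{span}\{|x\rangle^{\mathcal F}: x\in\mathcal A_d^{(p+1)n},\ |w(s(x))-w(s(q))|\le\delta\}\otimes\mathcal H_E$. Write $|\phi^t_q\rangle=\sum_{x\in\mathcal A_d^{pn}}\beta_x|x\rangle^{\mathcal F}_{B_1\cdots B_p}\otimes|\psi_x\rangle_{AE}$ with unit vectors $|\psi_x\rangle$, let $\sigma^{(x)}_{AE}=|\psi_x\rangle\langle\psi_x|$, and let $\sigma_{AE}$ be the state obtained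 from $|\phi^t_q\rangle\langle\phi^t_q|$ by tracing out $B_1,\dots,B_p$. Then $$H_\infty(A_Z|E)_\sigma\ \ge\ \min_{x:\,\beta_x\ne 0}H_\infty(A_Z|E)_{\sigma^{(x)}}\ \ge\ n\left(\log_2 d-\frac{H_d(w(s(q))+\delta)}{\log_d 2}\right).$$ -/

import Mathlib

open scoped TensorProduct

noncomputable section

namespace QCKA

/-! ### Words, relative Hamming weight, mod-`d` sums, the `d`-ary entropy function -/

/-- A joint word of `r` parties over the alphabet `ZMod d`, whose characters are indexed by the
positions `κ`: party `j` holds the string `q j : κ → ZMod d`. -/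
abbrev Word (d r : ℕ) (κ : Type) : Type := Fin r → κ → ZMod d

/-- Relative Hamming weight: the fraction of nonzero characters of a word. -/
def relWeight {d : ℕ} {κ : Type} [Fintype κ] (x : κ → ZMod d) : ℝ :=
  (hammingNorm x : ℝ) / (Fintype.card κ : ℝ)

/-- The mod-`d` sum string `s(q)`: position by position, the sum modulo `d` of the characters
of all parties. -/
def sumWord {d r : ℕ} {κ : Type} (q : Word d r κ) : κ → ZMod d := fun i => ∑ j, q j i

/-- The `d`-ary entropy function. -/
def dEntropy (d : ℕ) (x : ℝ) : ℝ :=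
  x * Real.logb d ((d : ℝ) - 1) - x * Real.logb d x - (1 - x) * Real.logb d (1 - x)

/-- The restriction of a joint word to a set of positions. -/
def restrict {d r : ℕ} {κ : Type} (P : κ → Prop) (q : Word d r κ) : Word d r {i // P i} :=
  fun j i => q j i.1

/-- The good words for the sampled subset `t`: the sum strings of the observed and of the
unobserved parts have relative weights that differ by at most `δ`. -/
def goodWords {d r N : ℕ} (t : Finset (Fin N)) (δ : ℝ) : Set (Word d r (Fin N)) :=
  {q | |relWeight (sumWord (restrict (fun i => i ∈ t) q)) -
      relWeight (sumWord (restrict (fun i => i ∉ t) q))| ≤ δ}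

/-! ### Registers and the Fourier basis

A quantum register of `d`-level systems is `EuclideanSpace ℂ W`, where `W` is the finite type of
words in these systems and the standard basis is the computational basis `Z`. -/

/-- The Fourier basis vector `|q⟩^𝓕` of a joint word: the tensor product over all parties and
positions of `|a⟩^𝓕 = d^(-1/2) ∑ k, exp (2 π i a k / d) |k⟩`, in computational coordinates. -/
def fourierKet {d r : ℕ} {κ : Type} [Fintype κ] (q : Word d r κ) :
    EuclideanSpace ℂ (Word d r κ) :=
  WithLp.toLp 2 fun k => ∏ j, ∏ i,
    ((1 / Real.sqrt d : ℝ) : ℂ) *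
      Complex.exp (2 * Real.pi * Complex.I * ((q j i).val : ℂ) * ((k j i).val : ℂ) / (d : ℂ))

/-- `span {|q⟩^𝓕 : q ∈ G} ⊗ H_E`, as a subspace of the joint space. -/
def fourierSpan {d r : ℕ} {κ : Type} [Fintype κ] (E : Type*) [NormedAddCommGroup E]
    [InnerProductSpace ℂ E] (G : Set (Word d r κ)) :
    Submodule ℂ (EuclideanSpace ℂ (Word d r κ) ⊗[ℂ] E) :=
  Submodule.span ℂ {v | ∃ q ∈ G, ∃ e : E, v = fourierKet q ⊗ₜ[ℂ] e}

/-! ### Partial bras and kets, partial trace, measurement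

`e : α ≃ β × γ` splits a register into two subregisters: `ℂ^α ≅ ℂ^β ⊗ ℂ^γ`. -/

section Registers

variable {α β γ : Type} [Fintype α] [Fintype β] [Fintype γ]

/-- `⟨χ| ⊗ id : ℂ^α ≅ ℂ^β ⊗ ℂ^γ → ℂ^γ`. -/
def partialBra (e : α ≃ β × γ) (χ : EuclideanSpace ℂ β) :
    EuclideanSpace ℂ α →ₗ[ℂ] EuclideanSpace ℂ γ where
  toFun v := WithLp.toLp 2 fun c => ∑ b, star (χ b) * v (e.symm (b, c))
  map_add' v w := by
    ext c
    simp [mul_add, Finset.sum_add_distrib]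
  map_smul' a v := by
    ext c
    simp [Finset.mul_sum, mul_left_comm]

/-- `|χ⟩ ⊗ id : ℂ^γ → ℂ^β ⊗ ℂ^γ ≅ ℂ^α`. -/
def partialKet (e : α ≃ β × γ) (χ : EuclideanSpace ℂ β) :
    EuclideanSpace ℂ γ →ₗ[ℂ] EuclideanSpace ℂ α where
  toFun v := WithLp.toLp 2 fun a => χ (e a).1 * v (e a).2
  map_add' v w := by
    ext a
    simp [mul_add]
  map_smul' a v := by
    ext c
    simp [mul_left_comm]

variable {E : Type*} [NormedAddCommGroup E] [InnerProductSpace ℂ E]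

/-- The partial trace over the first subregister `ℂ^β` of an operator on `ℂ^α ⊗ H_E`:
`∑ b, (⟨b| ⊗ id) ρ (|b⟩ ⊗ id)`. -/
def partialTrace [DecidableEq β] (e : α ≃ β × γ)
    (ρ : (EuclideanSpace ℂ α ⊗[ℂ] E) →ₗ[ℂ] (EuclideanSpace ℂ α ⊗[ℂ] E)) :
    (EuclideanSpace ℂ γ ⊗[ℂ] E) →ₗ[ℂ] (EuclideanSpace ℂ γ ⊗[ℂ] E) :=
  ∑ b : β, (partialBra e (EuclideanSpace.single b (1 : ℂ))).rTensor E ∘ₗ ρ ∘ₗ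
    (partialKet e (EuclideanSpace.single b (1 : ℂ))).rTensor E

/-- The operator `|v⟩⟨v|`. -/
def ketbra {H : Type*} [NormedAddCommGroup H] [InnerProductSpace ℂ H] (v : H) : H →ₗ[ℂ] H :=
  (InnerProductSpace.rankOne ℂ v v : H →L[ℂ] H).toLinearMap

/-- The normalized vector `v / ‖v‖`. -/
def unitVec {H : Type*} [NormedAddCommGroup H] [InnerProductSpace ℂ H] (v : H) : H :=
  ((‖v‖⁻¹ : ℝ) : ℂ) • v

/-- The state after a measurement of the register `ℂ^γ` in the computational basis:
`∑ z, (|z⟩⟨z| ⊗ id) ρ (|z⟩⟨z| ⊗ id)`. -/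
def measureZ [DecidableEq γ]
    (ρ : (EuclideanSpace ℂ γ ⊗[ℂ] E) →ₗ[ℂ] (EuclideanSpace ℂ γ ⊗[ℂ] E)) :
    (EuclideanSpace ℂ γ ⊗[ℂ] E) →ₗ[ℂ] (EuclideanSpace ℂ γ ⊗[ℂ] E) :=
  ∑ z : γ, (ketbra (EuclideanSpace.single z (1 : ℂ))).rTensor E ∘ₗ ρ ∘ₗ
    (ketbra (EuclideanSpace.single z (1 : ℂ))).rTensor E

/-- Density operators on a Hilbert space: positive operators of unit trace. (The sum of the
diagonal matrix elements of a positive operator is the same in all Hilbert bases, every Hilbert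
space has a Hilbert basis, and an everywhere defined positive operator is bounded.) -/
def IsDensityOperator (σ : E →ₗ[ℂ] E) : Prop :=
  σ.IsPositive ∧
    ∀ (w : Set E) (b : HilbertBasis w ℂ E), HasSum (fun i => inner ℂ (b i) (σ (b i))) (1 : ℂ)

/-- The conditional min-entropy `H_∞(A|E)_ρ`, for the register `A = ℂ^γ`: the supremum over all
density operators `σ` on `H_E` and all real `l` with `2^(-l) I_A ⊗ σ - ρ ≥ 0`, taken in the
extended reals so that an empty set of `l` contributes `-∞`. -/
def minEntropy (ρ : (EuclideanSpace ℂ γ ⊗[ℂ] E) →ₗ[ℂ] (EuclideanSpace ℂ γ ⊗[ℂ] E)) : EReal :=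
  ⨆ (σ : E →ₗ[ℂ] E) (_ : IsDensityOperator σ) (l : ℝ)
    (_ : ((((2 : ℝ) ^ (-l) : ℝ) : ℂ) • σ.lTensor (EuclideanSpace ℂ γ) - ρ).IsPositive), (l : EReal)

end Registers

/-! ### The splittings used in the protocol -/

/-- Splits a joint word into its part at the positions where `P` holds, and the rest. -/
def splitPositions (d r : ℕ) {κ : Type} (P : κ → Prop) [DecidablePred P] :
    Word d r κ ≃ Word d r {i // P i} × Word d r {i // ¬ P i} where
  toFun q := (restrict P q, restrict (fun i => ¬ P i) q)
  invFun u := fun j i => if h : P i then u.1 j ⟨i, h⟩ else u.2 j ⟨i, h⟩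
  left_inv q := by
    funext j i
    by_cases h : P i <;> simp [restrict, h]
  right_inv u := by
    ext j i
    · simp [restrict, i.2]
    · simp [restrict, i.2]

/-- Splits a joint word of Alice (party `0`) and `p` Bobs into the word of the Bobs and the string
of Alice. -/
def splitAlice (d p : ℕ) (κ : Type) : Word d (p + 1) κ ≃ Word d p κ × (κ → ZMod d) where
  toFun q := (fun j => q j.succ, q 0)
  invFun u := Fin.cons u.2 u.1
  left_inv q := by
    funext j
    refine Fin.cases ?_ (fun j => ?_) j <;> simp
  right_inv u := by simp

section Protocol

variable {d : ℕ} [NeZero d] {E : Type*} [NormedAddCommGroup E] [InnerProductSpace ℂ E]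

/-- The unnormalized vector `(⟨q|^𝓕 ⊗ id) φ` left on the unmeasured systems when the systems at
the positions in `t` are measured in the Fourier basis with outcome `q`. Its squared norm is the
probability of the outcome `q`. -/
def sampleBranch {r N : ℕ} (t : Finset (Fin N)) (q : Word d r {i // i ∈ t})
    (φ : EuclideanSpace ℂ (Word d r (Fin N)) ⊗[ℂ] E) :
    EuclideanSpace ℂ (Word d r {i // i ∉ t}) ⊗[ℂ] E :=
  (partialBra (splitPositions d r (fun i => i ∈ t)) (fourierKet q)).rTensor E φ

/-- The collapsed (normalized) state after the Fourier measurement at `t` with outcome `q`. -/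
def collapsed {r N : ℕ} (t : Finset (Fin N)) (q : Word d r {i // i ∈ t})
    (φ : EuclideanSpace ℂ (Word d r (Fin N)) ⊗[ℂ] E) :
    EuclideanSpace ℂ (Word d r {i // i ∉ t}) ⊗[ℂ] E :=
  unitVec (sampleBranch t q φ)

variable {p : ℕ} {κ : Type} [Fintype κ] [DecidableEq κ]

/-- The component of `ψ` at the Fourier basis vector `|x⟩^𝓕` of the Bobs: the vector
`β_x |ψ_x⟩` of `A ⊗ E` in `ψ = ∑ x, β_x |x⟩^𝓕_B ⊗ |ψ_x⟩_{AE}`. -/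
def bobBranch (ψ : EuclideanSpace ℂ (Word d (p + 1) κ) ⊗[ℂ] E) (x : Word d p κ) :
    EuclideanSpace ℂ (κ → ZMod d) ⊗[ℂ] E :=
  (partialBra (splitAlice d p κ) (fourierKet x)).rTensor E ψ

/-- The state `σ_{AE}`: the pure state `ψ` with all the Bobs traced out. -/
def stateAE (ψ : EuclideanSpace ℂ (Word d (p + 1) κ) ⊗[ℂ] E) :
    (EuclideanSpace ℂ (κ → ZMod d) ⊗[ℂ] E) →ₗ[ℂ] (EuclideanSpace ℂ (κ → ZMod d) ⊗[ℂ] E) :=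
  partialTrace (splitAlice d p κ) (ketbra ψ)

/-- The pure state `σ^(x)_{AE} = |ψ_x⟩⟨ψ_x|`, where `ψ = ∑ x, β_x |x⟩^𝓕_B ⊗ |ψ_x⟩_{AE}` with
unit vectors `ψ_x`; meaningful when the component at `x` does not vanish. -/
def stateAEGiven (ψ : EuclideanSpace ℂ (Word d (p + 1) κ) ⊗[ℂ] E) (x : Word d p κ) :
    (EuclideanSpace ℂ (κ → ZMod d) ⊗[ℂ] E) →ₗ[ℂ] (EuclideanSpace ℂ (κ → ZMod d) ⊗[ℂ] E) :=
  ketbra (unitVec (bobBranch ψ x))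

end Protocol

end QCKA

end

noncomputable section

namespace QCKA

/-! Projecting the sampled positions onto a Fourier outcome `q` kills every Fourier ket whose
restriction to `t` is not `q`. The surviving kets have sum strings within `δ` of the weight of
`s(q)`, which gives the first claim (`collapsed_mem_fourierSpan`).

Fix a Fourier word `x` of the Bobs. The corresponding branch on `A ⊗ E` is `∑ a ∈ J, stringKet a ⊗ e
a`, where every `a ∈ J` has `a + s(x)` in the Hamming ball of relative radius `w(s(q)) + δ`. The
ball has at most `d ^ (n H_d)` elements (`card_hammingBall_le`). Each Fourier vector is flat in the
`Z` basis, with squared amplitudes `d ^ (-n)`, so Cauchy–Schwarz in each block `z` bounds the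
measured state by `J.card * d ^ (-n)` times `I ⊗ ∑ a ∈ J, |e a⟩⟨e a|`
(`le_minEntropy_measureZ_ketbra`). The second factor is a density operator, whence the lower bound
for every branch.

The partial trace may be evaluated in the Fourier basis of the Bobs, so `σ_{AE}` is the mixture of
its branches with weights `|β_x|²`, and so is its measured version. The min-entropy of a mixture is
at least the minimum over its components (`le_minEntropy_sum_smul`). -/

/-! ### Fourier kets -/

/-- The coordinate `d^(-1/2) exp (2 π i a k / d)` of a one-system Fourier basis vector. -/
def fourierCoeff (d : ℕ) (a k : ZMod d) : ℂ :=
  ((1 / Real.sqrt d : ℝ) : ℂ) *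
    Complex.exp (2 * Real.pi * Complex.I * (a.val : ℂ) * (k.val : ℂ) / (d : ℂ))

theorem fourierCoeff_comm (d : ℕ) (a k : ZMod d) : fourierCoeff d a k = fourierCoeff d k a := by
  simp only [fourierCoeff]
  congr 3
  ring

theorem fourierCoeff_eq (d : ℕ) [NeZero d] (a k : ZMod d) :
    fourierCoeff d a k = ((1 / Real.sqrt d : ℝ) : ℂ) * ZMod.stdAddChar (a * k) := by
  have h : ((a.val * k.val : ℕ) : ZMod d) = a * k := by simp
  rw [fourierCoeff, ← h, ZMod.stdAddChar_apply, ZMod.toCircle_natCast]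
  push_cast
  congr 3
  ring

theorem star_stdAddChar (d : ℕ) [NeZero d] (a : ZMod d) :
    star (ZMod.stdAddChar a) = (ZMod.stdAddChar (-a) : ℂ) := by
  rw [ZMod.stdAddChar_apply, ZMod.stdAddChar_apply, AddChar.map_neg_eq_inv, Circle.coe_inv_eq_conj]
  rfl

theorem sum_star_fourierCoeff_mul (d : ℕ) [NeZero d] (a b : ZMod d) :
    ∑ k, star (fourierCoeff d a k) * fourierCoeff d b k = if a = b then 1 else 0 := by
  have hd : (0 : ℝ) < d := Nat.cast_pos.2 (NeZero.pos d)
  have key : ∀ k : ZMod d, star (fourierCoeff d a k) * fourierCoeff d b k =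
      (d : ℂ)⁻¹ * ZMod.stdAddChar (k * (b - a)) := by
    intro k
    have h1 : ((1 / Real.sqrt d : ℝ) : ℂ) * ((1 / Real.sqrt d : ℝ) : ℂ) = (d : ℂ)⁻¹ := by
      rw [← Complex.ofReal_mul, div_mul_div_comm, Real.mul_self_sqrt hd.le]
      simp
    have h2 : (ZMod.stdAddChar (k * (b - a)) : ℂ) =
        ZMod.stdAddChar (-(a * k)) * ZMod.stdAddChar (b * k) := by
      rw [← AddChar.map_add_eq_mul]
      congr 1
      ring
    rw [fourierCoeff_eq, fourierCoeff_eq, star_mul', star_stdAddChar, h2, ← h1,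
      Complex.star_def, Complex.conj_ofReal]
    ring
  simp_rw [key]
  rw [← Finset.mul_sum, AddChar.sum_mulShift _ (ZMod.isPrimitive_stdAddChar d)]
  have : (d : ℂ) ≠ 0 := by exact_mod_cast hd.ne'
  by_cases h : a = b
  · simp [h, this]
  · simp [h, sub_eq_zero, Ne.symm h]

theorem normSq_fourierCoeff (d : ℕ) (a k : ZMod d) : ‖fourierCoeff d a k‖ ^ 2 = (d : ℝ)⁻¹ := by
  have h : 2 * Real.pi * Complex.I * (a.val : ℂ) * (k.val : ℂ) / (d : ℂ) =
      ((2 * Real.pi * a.val * k.val / d : ℝ) : ℂ) * Complex.I := by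
    push_cast
    ring
  rw [fourierCoeff, h, norm_mul, Complex.norm_exp_ofReal_mul_I, Complex.norm_real, mul_one,
    Real.norm_eq_abs, sq_abs, div_pow, Real.sq_sqrt d.cast_nonneg]
  simp

/-- Sums of products of coordinatewise orthonormal families. -/
theorem sum_star_prod_mul_prod {ι A : Type*} [Fintype ι] [DecidableEq ι] [Fintype A]
    [DecidableEq A] (f : A → A → ℂ)
    (hf : ∀ a b, ∑ k, star (f a k) * f b k = if a = b then 1 else 0) (a b : ι → A) :
    ∑ k : ι → A, star (∏ i, f (a i) (k i)) * ∏ i, f (b i) (k i) = if a = b then 1 else 0 := by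
  have h := Finset.prod_univ_sum (R := ℂ) (fun _ : ι => (Finset.univ : Finset A))
    (fun i k => star (f (a i) k) * f (b i) k)
  rw [Fintype.piFinset_univ] at h
  simp_rw [star_prod, ← Finset.prod_mul_distrib]
  rw [← h]
  simp_rw [hf]
  rw [Finset.prod_ite_zero]
  simp [funext_iff]

/-- The Fourier basis vector of a string held by one party. -/
def stringKet {d : ℕ} {κ : Type} [Fintype κ] (a : κ → ZMod d) : EuclideanSpace ℂ (κ → ZMod d) :=
  WithLp.toLp 2 fun k => ∏ i, fourierCoeff d (a i) (k i)

theorem stringKet_apply {d : ℕ} {κ : Type} [Fintype κ] (a k : κ → ZMod d) :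
    stringKet a k = ∏ i, fourierCoeff d (a i) (k i) := rfl

theorem fourierKet_apply {d r : ℕ} {κ : Type} [Fintype κ] (q k : Word d r κ) :
    fourierKet q k = ∏ j, stringKet (q j) (k j) := rfl

/-- Fourier and computational bases are mutually unbiased; this is the source of the term `n log d`
in the bound. -/
theorem normSq_stringKet_apply {d : ℕ} {κ : Type} [Fintype κ] (a k : κ → ZMod d) :
    ‖stringKet a k‖ ^ 2 = ((d : ℝ) ^ Fintype.card κ)⁻¹ := by
  rw [stringKet_apply, norm_prod, ← Finset.prod_pow]
  simp [normSq_fourierCoeff]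

theorem fourierKet_comm {d r : ℕ} {κ : Type} [Fintype κ] (q k : Word d r κ) :
    fourierKet q k = fourierKet k q := by
  simp_rw [fourierKet_apply, stringKet_apply]
  exact Finset.prod_congr rfl fun j _ => Finset.prod_congr rfl fun i _ => fourierCoeff_comm _ _ _

section Orthonormal

variable {d : ℕ} [NeZero d] {κ : Type} [Fintype κ] [DecidableEq κ]

theorem sum_star_stringKet_mul (a b : κ → ZMod d) :
    ∑ k, star (stringKet a k) * stringKet b k = if a = b then 1 else 0 :=
  sum_star_prod_mul_prod _ (sum_star_fourierCoeff_mul d) a b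

theorem sum_star_fourierKet_mul {r : ℕ} (a b : Word d r κ) :
    ∑ k, star (fourierKet a k) * fourierKet b k = if a = b then 1 else 0 :=
  sum_star_prod_mul_prod _ sum_star_stringKet_mul a b

/-- Completeness follows from orthonormality because the Fourier matrix is symmetric. -/
theorem sum_star_fourierKet_mul' {r : ℕ} (k l : Word d r κ) :
    ∑ q, star (fourierKet q k) * fourierKet q l = if k = l then 1 else 0 := by
  simp_rw [fun q => fourierKet_comm q k, fun q => fourierKet_comm q l]
  exact sum_star_fourierKet_mul k l

theorem orthonormal_stringKet :
    Orthonormal ℂ (stringKet : (κ → ZMod d) → EuclideanSpace ℂ (κ → ZMod d)) := by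
  rw [orthonormal_iff_ite]
  intro a b
  rw [← sum_star_stringKet_mul, PiLp.inner_apply]
  simp [mul_comm]

end Orthonormal

/-! ### Partial bras of Fourier kets -/

theorem partialBra_of_mul {α β γ : Type} [Fintype α] [Fintype β] [Fintype γ] (e : α ≃ β × γ)
    (χ : EuclideanSpace ℂ β) (v : EuclideanSpace ℂ α) (f : EuclideanSpace ℂ β)
    (g : EuclideanSpace ℂ γ) (h : ∀ b c, v (e.symm (b, c)) = f b * g c) :
    partialBra e χ v = (∑ b, star (χ b) * f b) • g := by
  ext c
  simp [partialBra, h, Finset.sum_mul, mul_assoc]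

theorem fourierKet_splitPositions_symm {d r : ℕ} {κ : Type} [Fintype κ] (P : κ → Prop)
    [DecidablePred P] [Fintype {i // P i}] [Fintype {i // ¬ P i}] (q : Word d r κ)
    (u : Word d r {i // P i}) (v : Word d r {i // ¬ P i}) :
    fourierKet q ((splitPositions d r P).symm (u, v)) =
      fourierKet (restrict P q) u * fourierKet (restrict (fun i => ¬ P i) q) v := by
  simp_rw [fourierKet_apply, ← Finset.prod_mul_distrib, stringKet_apply]
  refine Finset.prod_congr rfl fun j _ => ?_
  rw [← Fintype.prod_subtype_mul_prod_subtype P]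
  congr 1
  · refine Finset.prod_congr (Finset.ext (by simp)) fun i _ => ?_
    simp [splitPositions, restrict, i.2]
  · refine Finset.prod_congr (Finset.ext (by simp)) fun i _ => ?_
    simp [splitPositions, restrict, i.2]

theorem fourierKet_splitAlice_symm {d p : ℕ} {κ : Type} [Fintype κ] (q : Word d (p + 1) κ)
    (u : Word d p κ) (v : κ → ZMod d) :
    fourierKet q ((splitAlice d p κ).symm (u, v)) =
      fourierKet (fun j => q j.succ) u * stringKet (q 0) v := by
  simp_rw [fourierKet_apply]
  rw [Fin.prod_univ_succ, mul_comm]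
  simp [splitAlice]

theorem partialBra_splitPositions_fourierKet {d r : ℕ} [NeZero d] {κ : Type} [Fintype κ]
    [DecidableEq κ] (P : κ → Prop) [DecidablePred P] [Fintype {i // P i}] [Fintype {i // ¬ P i}]
    (a : Word d r {i // P i}) (q : Word d r κ) :
    partialBra (splitPositions d r P) (fourierKet a) (fourierKet q) =
      if a = restrict P q then fourierKet (restrict (fun i => ¬ P i) q) else 0 := by
  rw [partialBra_of_mul _ _ _ _ _ (fourierKet_splitPositions_symm P q), sum_star_fourierKet_mul]
  split_ifs <;> simp

theorem partialBra_splitAlice_fourierKet {d p : ℕ} [NeZero d] {κ : Type} [Fintype κ]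
    [DecidableEq κ] (a : Word d p κ) (q : Word d (p + 1) κ) :
    partialBra (splitAlice d p κ) (fourierKet a) (fourierKet q) =
      if a = fun j => q j.succ then stringKet (q 0) else 0 := by
  rw [partialBra_of_mul _ _ _ _ _ (fourierKet_splitAlice_symm q), sum_star_fourierKet_mul]
  split_ifs <;> simp

/-! ### Fourier spans under partial Fourier measurements -/

section Spans

variable {E : Type*} [NormedAddCommGroup E] [InnerProductSpace ℂ E] {d : ℕ} [NeZero d]

theorem collapsed_mem_fourierSpan {r N : ℕ} (t : Finset (Fin N)) (δ : ℝ)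
    {φ : EuclideanSpace ℂ (Word d r (Fin N)) ⊗[ℂ] E} (hφ : φ ∈ fourierSpan E (goodWords t δ))
    (q : Word d r {i // i ∈ t}) :
    collapsed t q φ ∈ fourierSpan E {x : Word d r {i // i ∉ t} |
      |relWeight (sumWord x) - relWeight (sumWord q)| ≤ δ} := by
  refine Submodule.smul_mem _ _ ?_
  rw [sampleBranch, ← Submodule.mem_comap (f := (partialBra (splitPositions d r (fun i => i ∈ t))
    (fourierKet q)).rTensor E)]
  refine Submodule.span_le.2 ?_ hφ
  rintro _ ⟨x, hx, e, rfl⟩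
  simp only [Submodule.comap_coe, Set.mem_preimage, LinearMap.rTensor_tmul, SetLike.mem_coe,
    partialBra_splitPositions_fourierKet]
  split_ifs with h
  · refine Submodule.subset_span ⟨_, ?_, e, rfl⟩
    rw [Set.mem_ofPred_eq, abs_sub_comm, h]
    exact hx
  · simp

theorem bobBranch_mem_span {p : ℕ} {κ : Type} [Fintype κ] [DecidableEq κ]
    {G : Set (Word d (p + 1) κ)} {ψ : EuclideanSpace ℂ (Word d (p + 1) κ) ⊗[ℂ] E}
    (hψ : ψ ∈ fourierSpan E G) (x : Word d p κ) :
    bobBranch ψ x ∈ Submodule.span ℂ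
      {v | ∃ a : κ → ZMod d, Fin.cons (α := fun _ => κ → ZMod d) a x ∈ G ∧
        ∃ e : E, v = stringKet a ⊗ₜ[ℂ] e} := by
  rw [bobBranch, ← Submodule.mem_comap (f := (partialBra (splitAlice d p κ)
    (fourierKet x)).rTensor E)]
  refine Submodule.span_le.2 ?_ hψ
  rintro _ ⟨y, hy, e, rfl⟩
  simp only [Submodule.comap_coe, Set.mem_preimage, LinearMap.rTensor_tmul, SetLike.mem_coe,
    partialBra_splitAlice_fourierKet]
  split_ifs with h
  · refine Submodule.subset_span ⟨_, ?_, e, rfl⟩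
    rw [h]
    convert hy
    exact Fin.cons_self_tail y
  · simp

/-- Elements of the span of `v a ⊗ e`, `a ∈ J`, have the form `∑ a ∈ J, v a ⊗ e a`. -/
theorem exists_eq_sum_tmul {ι H : Type*} [AddCommGroup H] [Module ℂ H] (J : Finset ι)
    (v : ι → H) {ψ : H ⊗[ℂ] E}
    (hψ : ψ ∈ Submodule.span ℂ {w | ∃ a ∈ J, ∃ e : E, w = v a ⊗ₜ[ℂ] e}) :
    ∃ e : ι → E, ψ = ∑ a ∈ J, v a ⊗ₜ[ℂ] e a := by
  classical
  induction hψ using Submodule.span_induction with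
  | mem w hw =>
    obtain ⟨a, ha, e, rfl⟩ := hw
    refine ⟨Pi.single a e, ?_⟩
    rw [Finset.sum_eq_single_of_mem a ha, Pi.single_eq_same]
    intro b _ hb
    rw [Pi.single_eq_of_ne hb, TensorProduct.tmul_zero]
  | zero => exact ⟨0, by simp⟩
  | add x y _ _ hx hy =>
    obtain ⟨e, rfl⟩ := hx
    obtain ⟨f, rfl⟩ := hy
    exact ⟨e + f, by simp [TensorProduct.tmul_add, Finset.sum_add_distrib]⟩
  | smul c x _ hx =>
    obtain ⟨e, rfl⟩ := hx
    exact ⟨c • e, by simp [Finset.smul_sum]⟩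

end Spans

/-! ### The volume of a Hamming ball -/

/-- Total mass of the product distribution in which each character is nonzero with probability `r`,
uniformly among the `d - 1` nonzero values. -/
theorem sum_prod_ite_eq_one (d : ℕ) [NeZero d] (hd : 2 ≤ d) (κ : Type) [Fintype κ] [DecidableEq κ]
    (r : ℝ) :
    ∑ y : κ → ZMod d, ∏ i, (if y i ≠ 0 then r / ((d : ℝ) - 1) else 1 - r) = 1 := by
  have h := Finset.prod_univ_sum (R := ℝ) (fun _ : κ => (Finset.univ : Finset (ZMod d)))
    (fun _ k => if k ≠ 0 then r / ((d : ℝ) - 1) else 1 - r)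
  rw [Fintype.piFinset_univ] at h
  rw [← h]
  refine Finset.prod_eq_one fun _ _ => ?_
  have hd' : (d : ℝ) - 1 ≠ 0 := by
    have : (2 : ℝ) ≤ d := by exact_mod_cast hd
    linarith
  rw [← Finset.add_sum_erase _ _ (Finset.mem_univ (0 : ZMod d)),
    Finset.sum_congr rfl (g := fun _ => r / ((d : ℝ) - 1))
      fun x hx => if_pos (Finset.ne_of_mem_erase hx)]
  rw [Finset.sum_const, Finset.card_erase_of_mem (Finset.mem_univ _), Finset.card_univ, ZMod.card,
    nsmul_eq_mul, Nat.cast_sub (by omega)]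
  simp only [ne_eq, not_true_eq_false, if_false, Nat.cast_one]
  field_simp
  ring

theorem prod_ite_eq_pow (d : ℕ) (κ : Type) [Fintype κ] (y : κ → ZMod d) (a b : ℝ) :
    ∏ i, (if y i ≠ 0 then a else b) =
      a ^ hammingNorm y * b ^ (Fintype.card κ - hammingNorm y) := by
  classical
  rw [Finset.prod_ite, Finset.prod_const, Finset.prod_const, hammingNorm]
  congr 2
  rw [Finset.filter_not, Finset.card_sdiff_of_subset (Finset.filter_subset _ _), Finset.card_univ]

/-- The right side is the formal mass of a word of weight exactly `n * r` under that distribution.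
-/
theorem rpow_neg_dEntropy (d : ℕ) (hd : 2 ≤ d) {r : ℝ} (h0 : 0 < r) (h1 : r < 1) (n : ℝ) :
    (d : ℝ) ^ (-(n * dEntropy d r)) = (1 - r) ^ n * (r / (((d : ℝ) - 1) * (1 - r))) ^ (n * r) := by
  have hd1 : (1 : ℝ) < d := by exact_mod_cast hd
  have hl : Real.log d ≠ 0 := (Real.log_pos hd1).ne'
  have h1' : 0 < 1 - r := by linarith
  have hd' : 0 < (d : ℝ) - 1 := by linarith
  have hpos : 0 < r / (((d : ℝ) - 1) * (1 - r)) := by positivity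
  rw [Real.rpow_def_of_pos (by linarith), Real.rpow_def_of_pos h1', Real.rpow_def_of_pos hpos,
    ← Real.exp_add, Real.log_div h0.ne' (by positivity), Real.log_mul hd'.ne' h1'.ne', dEntropy]
  congr 1
  simp only [Real.logb]
  field_simp
  ring

/-- Under the product distribution with parameter `r`, every word of `J` has mass at least `d ^ (-n
H_d(r))`, while the total mass is 1. -/
theorem card_hammingBall_le (d : ℕ) [NeZero d] (hd : 2 ≤ d) (κ : Type) [Fintype κ] [DecidableEq κ]
    [Nonempty κ] {r : ℝ} (h0 : 0 ≤ r) (h1 : r ≤ 1 - 1 / (d : ℝ)) (J : Finset (κ → ZMod d))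
    (hJ : ∀ y ∈ J, relWeight y ≤ r) :
    (J.card : ℝ) ≤ (d : ℝ) ^ ((Fintype.card κ : ℝ) * dEntropy d r) := by
  have hd1 : (1 : ℝ) < d := by exact_mod_cast hd
  have hn : (0 : ℝ) < Fintype.card κ := by exact_mod_cast Fintype.card_pos
  have hw : ∀ y ∈ J, (hammingNorm y : ℝ) ≤ Fintype.card κ * r := fun y hy => by
    have := hJ y hy
    rwa [relWeight, div_le_iff₀' hn] at this
  -- Radius 0 is separate because the logarithmic identity needs `0 < r`; there `Real.log 0 = 0`
  -- realizes the convention `0 log 0 = 0`.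
  rcases h0.eq_or_lt with rfl | h0
  · have hsub : J ⊆ {0} := fun y hy => by
      have := hw y hy
      rw [mul_zero] at this
      have h : hammingNorm y = 0 := by exact_mod_cast le_antisymm this (Nat.cast_nonneg _)
      simpa using h
    have hc := Finset.card_le_card hsub
    have he : dEntropy d 0 = 0 := by simp [dEntropy]
    rw [he, mul_zero, Real.rpow_zero]
    exact_mod_cast hc
  have hdpos : (0 : ℝ) < d := by linarith
  have hlt : r < 1 := by
    have : 0 < 1 / (d : ℝ) := by positivity
    linarith
  have h1' : 0 < 1 - r := by linarith
  have hd' : 0 < (d : ℝ) - 1 := by linarith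
  set θ : ℝ := r / (((d : ℝ) - 1) * (1 - r)) with hθ
  have hθ0 : 0 < θ := by positivity
  -- `θ` is the factor by which one more nonzero character changes the mass. It is at most 1 exactly
  -- when `r ≤ 1 - 1 / d`, and then the lightest words of the ball lie on its boundary.
  have hθ1 : θ ≤ 1 := by
    rw [hθ, div_le_one (by positivity)]
    have : r * d ≤ d - 1 := by
      calc r * d ≤ (1 - 1 / (d : ℝ)) * d := by gcongr
        _ = d - 1 := by field_simp
    nlinarith
  set W : ℝ := (d : ℝ) ^ (-((Fintype.card κ : ℝ) * dEntropy d r)) with hW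
  have hterm : ∀ y ∈ J, W ≤ ∏ i, (if y i ≠ 0 then r / ((d : ℝ) - 1) else 1 - r) := by
    intro y hy
    have hle : hammingNorm y ≤ Fintype.card κ := hammingNorm_le_card_fintype
    have hsplit : (1 - r) ^ Fintype.card κ =
        (1 - r) ^ hammingNorm y * (1 - r) ^ (Fintype.card κ - hammingNorm y) := by
      rw [← pow_add, Nat.add_sub_cancel' hle]
    have hre : r / ((d : ℝ) - 1) = θ * (1 - r) := by
      rw [hθ]
      field_simp
    rw [prod_ite_eq_pow, hW, rpow_neg_dEntropy d hd h0 hlt, ← hθ, hre, mul_pow, mul_assoc,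
      ← hsplit, Real.rpow_natCast, mul_comm]
    gcongr
    rw [← Real.rpow_natCast θ]
    exact Real.rpow_le_rpow_of_exponent_ge hθ0 hθ1 (hw y hy)
  have hsum : (J.card : ℝ) * W ≤ 1 := by
    rw [← sum_prod_ite_eq_one d hd κ r, ← nsmul_eq_mul]
    refine (Finset.card_nsmul_le_sum J _ W hterm).trans ?_
    refine Finset.sum_le_univ_sum_of_nonneg fun y => Finset.prod_nonneg fun i _ => ?_
    split_ifs <;> positivity
  rw [hW, Real.rpow_neg hdpos.le] at hsum
  have hp : 0 < (d : ℝ) ^ ((Fintype.card κ : ℝ) * dEntropy d r) := Real.rpow_pos_of_pos hdpos _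
  rwa [← div_eq_mul_inv, div_le_one hp] at hsum

/-- The bound also holds for translates of the ball. -/
theorem card_le_of_relWeight_add_le (d : ℕ) [NeZero d] (hd : 2 ≤ d) (κ : Type) [Fintype κ]
    [DecidableEq κ] [Nonempty κ] {r : ℝ} (h0 : 0 ≤ r) (h1 : r ≤ 1 - 1 / (d : ℝ))
    (s : κ → ZMod d) (J : Finset (κ → ZMod d)) (hJ : ∀ y ∈ J, relWeight (y + s) ≤ r) :
    (J.card : ℝ) ≤ (d : ℝ) ^ ((Fintype.card κ : ℝ) * dEntropy d r) := by
  rw [← Finset.card_image_of_injective J (add_left_injective s)]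
  refine card_hammingBall_le d hd κ h0 h1 _ fun y hy => ?_
  obtain ⟨z, hz, rfl⟩ := Finset.mem_image.1 hy
  exact hJ z hz

/-! ### Rank-one operators -/

section Ketbra

variable {H : Type*} [NormedAddCommGroup H] [InnerProductSpace ℂ H]

theorem ketbra_apply (v w : H) : ketbra v w = inner ℂ v w • v := rfl

theorem isPositive_ketbra (v : H) : (ketbra v).IsPositive :=
  (ContinuousLinearMap.isPositive_toLinearMap_iff _).2 (InnerProductSpace.isPositive_rankOne_self v)

theorem ketbra_smul (c : ℂ) (v : H) : ketbra (c • v) = ((‖c‖ ^ 2 : ℝ) : ℂ) • ketbra v := by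
  ext w
  simp only [ketbra_apply, LinearMap.smul_apply, inner_smul_left, smul_smul]
  congr 1
  rw [Complex.ofReal_pow, ← Complex.conj_mul']
  ring

theorem norm_unitVec {v : H} (hv : v ≠ 0) : ‖unitVec v‖ = 1 := by
  rw [unitVec, norm_smul, Complex.norm_real, norm_inv, norm_norm,
    inv_mul_cancel₀ (norm_ne_zero_iff.2 hv)]

theorem normSq_smul_ketbra_unitVec (v : H) :
    ((‖v‖ ^ 2 : ℝ) : ℂ) • ketbra (unitVec v) = ketbra v := by
  by_cases hv : v = 0
  · subst hv
    ext w
    simp [ketbra_apply]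
  · rw [unitVec, ketbra_smul, smul_smul, ← Complex.ofReal_mul, Complex.norm_real, norm_inv,
      norm_norm, ← mul_pow, mul_inv_cancel₀ (norm_ne_zero_iff.2 hv)]
    simp

/-- The adjoint is supplied as an explicit map `M`, so no completeness of the spaces is required;
this matters for the algebraic tensor product. -/
theorem comp_ketbra_comp {K : Type*} [NormedAddCommGroup K] [InnerProductSpace ℂ K]
    (L : H →ₗ[ℂ] K) (M : K →ₗ[ℂ] H) (h : ∀ v w, inner ℂ (L v) w = inner ℂ v (M w)) (ψ : H) :
    L ∘ₗ ketbra ψ ∘ₗ M = ketbra (L ψ) := by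
  ext w
  simp [ketbra_apply, h]

theorem normSq_inner_sum_le {ι : Type*} (s : Finset ι) (γ : ι → ℂ) (u : ι → H) (y : H) :
    ‖inner ℂ (∑ a ∈ s, γ a • u a) y‖ ^ 2 ≤
      (∑ a ∈ s, ‖γ a‖ ^ 2) * ∑ a ∈ s, ‖inner ℂ (u a) y‖ ^ 2 := by
  refine le_trans ?_ (Finset.sum_mul_sq_le_sq_mul_sq s (fun a => ‖γ a‖) fun a => ‖inner ℂ (u a) y‖)
  rw [sum_inner]
  gcongr
  refine (norm_sum_le _ _).trans (Finset.sum_le_sum fun a _ => ?_)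
  rw [inner_smul_left, norm_mul, RCLike.norm_conj]

theorem isSymmetric_ofReal_smul {T : H →ₗ[ℂ] H} (hT : T.IsSymmetric) (c : ℝ) :
    ((c : ℂ) • T).IsSymmetric := fun x y => by
  rw [LinearMap.smul_apply, LinearMap.smul_apply, inner_smul_left, inner_smul_right,
    Complex.conj_ofReal, hT x y]

theorem re_inner_ketbra (v y : H) :
    RCLike.re (inner ℂ (ketbra v y) y) = ‖inner ℂ v y‖ ^ 2 := by
  rw [ketbra_apply, inner_smul_left, RCLike.conj_mul]
  norm_cast

/-- The pinching inequality `|∑ γ a u a⟩⟨∑ γ a u a| ≤ c ∑ |u a⟩⟨u a|` for `∑ |γ a|² ≤ c`. -/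
theorem isPositive_smul_sum_ketbra_sub {ι : Type*} (s : Finset ι) (γ : ι → ℂ) (u : ι → H) {c : ℝ}
    (hc : ∑ a ∈ s, ‖γ a‖ ^ 2 ≤ c) :
    ((c : ℂ) • ∑ a ∈ s, ketbra (u a) - ketbra (∑ a ∈ s, γ a • u a)).IsPositive := by
  refine ⟨(isSymmetric_ofReal_smul
    (LinearMap.isPositive_sum s fun a _ => isPositive_ketbra (u a)).1 c).sub
    (isPositive_ketbra _).1, fun y => ?_⟩
  rw [LinearMap.sub_apply, inner_sub_left, map_sub, re_inner_ketbra, LinearMap.smul_apply,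
    inner_smul_left, Complex.conj_ofReal, RCLike.re_eq_complex_re, Complex.re_ofReal_mul,
    LinearMap.sum_apply, sum_inner, Complex.re_sum, sub_nonneg]
  simp_rw [← RCLike.re_eq_complex_re, re_inner_ketbra]
  exact (normSq_inner_sum_le s γ u y).trans
    (mul_le_mul_of_nonneg_right hc (Finset.sum_nonneg fun _ _ => by positivity))

/-- `∑ x, |∑ b, U x b w b⟩⟨∑ b, U x b w b| = ∑ b, |w b⟩⟨w b|` for `U` with orthonormal columns. -/
theorem sum_ketbra_of_orthonormal {ι κ : Type*} [Fintype ι] [Fintype κ] [DecidableEq κ]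
    (U : ι → κ → ℂ) (hU : ∀ b c, ∑ x, star (U x b) * U x c = if b = c then 1 else 0) (w : κ → H) :
    ∑ x, ketbra (∑ b, U x b • w b) = ∑ b, ketbra (w b) := by
  ext y
  have key : ∀ b c, ∑ x, (starRingEnd ℂ (U x b) * inner ℂ (w b) y) * U x c =
      (if b = c then 1 else 0) * inner ℂ (w b) y := fun b c => by
    rw [← hU, Finset.sum_mul]
    exact Finset.sum_congr rfl fun x _ => by rw [← Complex.star_def]; ring
  simp only [LinearMap.sum_apply, ketbra_apply, sum_inner, inner_smul_left, Finset.smul_sum,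
    smul_smul]
  rw [Finset.sum_comm]
  refine Finset.sum_congr rfl fun c _ => ?_
  simp_rw [Finset.sum_mul, Finset.sum_smul]
  rw [Finset.sum_comm]
  simp_rw [← Finset.sum_smul, key]
  simp

end Ketbra

/-! ### Density operators and the min-entropy of mixtures -/

section Density

variable {E : Type*} [NormedAddCommGroup E] [InnerProductSpace ℂ E]

theorem hasSum_inner_ketbra (v : E) (w : Set E) (b : HilbertBasis w ℂ E) :
    HasSum (fun i => inner ℂ (b i) (ketbra v (b i))) ((‖v‖ ^ 2 : ℝ) : ℂ) := by
  have h := b.hasSum_inner_mul_inner v v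
  rw [inner_self_eq_norm_sq_to_K] at h
  simpa [ketbra_apply, inner_smul_right] using h

theorem isDensityOperator_sum_ketbra {ι : Type*} (s : Finset ι) (v : ι → E)
    (hv : ∑ a ∈ s, ‖v a‖ ^ 2 = 1) : IsDensityOperator (∑ a ∈ s, ketbra (v a)) := by
  refine ⟨LinearMap.isPositive_sum s fun a _ => isPositive_ketbra _, fun w b => ?_⟩
  have h := hasSum_sum (s := s) fun a _ => hasSum_inner_ketbra (v a) w b
  rw [← Complex.ofReal_sum, hv, Complex.ofReal_one] at h
  simpa [LinearMap.sum_apply, inner_sum] using h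

theorem isDensityOperator_sum_smul {ι : Type*} (s : Finset ι) (c : ι → ℝ) (hc : ∀ i ∈ s, 0 ≤ c i)
    (h1 : ∑ i ∈ s, c i = 1) (σ : ι → E →ₗ[ℂ] E) (hσ : ∀ i ∈ s, IsDensityOperator (σ i)) :
    IsDensityOperator (∑ i ∈ s, (c i : ℂ) • σ i) := by
  refine ⟨LinearMap.isPositive_sum s fun i hi =>
    (hσ i hi).1.smul_of_nonneg (by exact_mod_cast hc i hi), fun w b => ?_⟩
  have h := hasSum_sum (s := s) fun i hi => ((hσ i hi).2 w b).mul_left (c i : ℂ)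
  simp only [mul_one] at h
  rw [← Complex.ofReal_sum, h1, Complex.ofReal_one] at h
  simpa [LinearMap.sum_apply, inner_sum, inner_smul_right] using h

theorem inner_rTensor {H K : Type*} [NormedAddCommGroup H] [InnerProductSpace ℂ H]
    [NormedAddCommGroup K] [InnerProductSpace ℂ K] (L : H →ₗ[ℂ] K) (M : K →ₗ[ℂ] H)
    (h : ∀ v w, inner ℂ (L v) w = inner ℂ v (M w)) (v : H ⊗[ℂ] E) (w : K ⊗[ℂ] E) :
    inner ℂ (L.rTensor E v) w = inner ℂ v (M.rTensor E w) := by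
  induction v using TensorProduct.induction_on with
  | zero => simp
  | add x y hx hy => rw [map_add, inner_add_left, inner_add_left, hx, hy]
  | tmul a e =>
    induction w using TensorProduct.induction_on with
    | zero => simp
    | add x y hx hy => rw [map_add, inner_add_right, inner_add_right, hx, hy]
    | tmul b f => simp [h]

variable {γ : Type} [Fintype γ]

/-- `ℂ^γ ⊗ σ` is block diagonal. -/
theorem lTensor_sum_ketbra [DecidableEq γ] {ι : Type*} (s : Finset ι) (v : ι → E) :
    (∑ a ∈ s, ketbra (v a)).lTensor (EuclideanSpace ℂ γ) =
      ∑ z : γ, ∑ a ∈ s, ketbra (EuclideanSpace.single z (1 : ℂ) ⊗ₜ[ℂ] v a) := by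
  refine TensorProduct.ext' fun x y => ?_
  have hx : x = ∑ z, x z • EuclideanSpace.single z (1 : ℂ) := by
    ext i
    simp [Pi.single_apply]
  simp only [LinearMap.lTensor_tmul, LinearMap.sum_apply, ketbra_apply,
    TensorProduct.inner_tmul, EuclideanSpace.inner_single_left, map_one, one_mul,
    TensorProduct.tmul_sum]
  rw [Finset.sum_comm]
  refine Finset.sum_congr rfl fun a _ => ?_
  conv_lhs => rw [hx]
  rw [TensorProduct.sum_tmul]
  refine Finset.sum_congr rfl fun z _ => ?_
  rw [TensorProduct.smul_tmul_smul]

theorem le_minEntropy {ρ : (EuclideanSpace ℂ γ ⊗[ℂ] E) →ₗ[ℂ] (EuclideanSpace ℂ γ ⊗[ℂ] E)}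
    {σ : E →ₗ[ℂ] E} (hσ : IsDensityOperator σ) {l : ℝ}
    (h : ((((2 : ℝ) ^ (-l) : ℝ) : ℂ) • σ.lTensor (EuclideanSpace ℂ γ) - ρ).IsPositive) :
    (l : EReal) ≤ minEntropy ρ :=
  le_iSup₂_of_le σ hσ (le_iSup₂_of_le l h le_rfl)

/-- The min-entropy of a mixture is at least the least min-entropy of its components. -/
theorem le_minEntropy_sum_smul [DecidableEq γ] {ι : Type*} (s : Finset ι) (c : ι → ℝ)
    (hc : ∀ i ∈ s, 0 ≤ c i) (h1 : ∑ i ∈ s, c i = 1)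
    (ρ : ι → (EuclideanSpace ℂ γ ⊗[ℂ] E) →ₗ[ℂ] (EuclideanSpace ℂ γ ⊗[ℂ] E)) (x : EReal)
    (hx : ∀ i ∈ s, x ≤ minEntropy (ρ i)) : x ≤ minEntropy (∑ i ∈ s, (c i : ℂ) • ρ i) := by
  -- The suprema need not be attained, so the argument runs with an arbitrary real `r` strictly
  -- below `x`.
  refine EReal.ge_of_forall_gt_iff_ge.1 fun r hr => ?_
  have h : ∀ i ∈ s, ∃ σ : E →ₗ[ℂ] E, IsDensityOperator σ ∧ ∃ l : ℝ, r ≤ l ∧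
      ((((2 : ℝ) ^ (-l) : ℝ) : ℂ) • σ.lTensor (EuclideanSpace ℂ γ) - ρ i).IsPositive := by
    intro i hi
    have := hr.trans_le (hx i hi)
    simp only [minEntropy, lt_iSup_iff] at this
    obtain ⟨σ, hσ, l, hl, hlt⟩ := this
    exact ⟨σ, hσ, l, (EReal.coe_lt_coe_iff.1 hlt).le, hl⟩
  choose! σ hσ l hl hpos using h
  -- Adding the inequalities `ρ i ≤ 2 ^ (-l i) I ⊗ σ i` with weights `c i` gives an operator on `E`
  -- of trace `K`; dividing by `K` makes it a density operator, with min-entropy witness `-logb 2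
  -- K`.
  set K : ℝ := ∑ i ∈ s, c i * (2 : ℝ) ^ (-l i) with hK
  have hKr : K ≤ (2 : ℝ) ^ (-r) := by
    calc K ≤ ∑ i ∈ s, c i * (2 : ℝ) ^ (-r) := Finset.sum_le_sum fun i hi =>
          mul_le_mul_of_nonneg_left (Real.rpow_le_rpow_of_exponent_le one_le_two
            (neg_le_neg (hl i hi))) (hc i hi)
      _ = (2 : ℝ) ^ (-r) := by rw [← Finset.sum_mul, h1, one_mul]
  have hK0 : 0 < K := by
    obtain ⟨i, hi, hci⟩ := Finset.exists_ne_zero_of_sum_ne_zero (h1.trans_ne one_ne_zero)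
    refine Finset.sum_pos' (fun j hj => mul_nonneg (hc j hj) (by positivity)) ⟨i, hi, ?_⟩
    exact mul_pos (lt_of_le_of_ne (hc i hi) hci.symm) (by positivity)
  have hle : r ≤ -Real.logb 2 K := by
    rw [le_neg, Real.logb_le_iff_le_rpow one_lt_two hK0]
    exact hKr
  refine le_trans (EReal.coe_le_coe_iff.2 hle) (le_minEntropy (isDensityOperator_sum_smul s
    (fun i => K⁻¹ * (c i * (2 : ℝ) ^ (-l i))) (fun i hi => mul_nonneg (inv_nonneg.2 hK0.le)
      (mul_nonneg (hc i hi) (by positivity))) ?_ σ hσ) ?_)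
  · rw [← Finset.mul_sum, ← hK, inv_mul_cancel₀ hK0.ne']
  · have hKC : (K : ℂ) ≠ 0 := by exact_mod_cast hK0.ne'
    rw [neg_neg, Real.rpow_logb two_pos (by norm_num) hK0, ← LinearMap.coe_lTensorHom, map_sum,
      Finset.smul_sum, ← Finset.sum_sub_distrib]
    refine LinearMap.isPositive_sum s fun i hi => ?_
    have := (hpos i hi).smul_of_nonneg (c := (c i : ℂ)) (by exact_mod_cast hc i hi)
    rw [smul_sub, smul_smul] at this
    rw [map_smul, smul_smul, LinearMap.coe_lTensorHom]
    convert this using 3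
    push_cast
    rw [mul_inv_cancel_left₀ hKC]

end Density

/-! ### Measured and reduced pure states -/

section Measured

variable {E : Type*} [NormedAddCommGroup E] [InnerProductSpace ℂ E]

theorem inner_self_eq_ofReal {H : Type*} [NormedAddCommGroup H] [InnerProductSpace ℂ H] (v : H) :
    inner ℂ v v = ((‖v‖ ^ 2 : ℝ) : ℂ) := by
  rw [inner_self_eq_norm_sq_to_K]
  simp

theorem sum_normSq_of_sum_comp_eq {ι H K : Type*} [Fintype ι] [NormedAddCommGroup H]
    [InnerProductSpace ℂ H] [NormedAddCommGroup K] [InnerProductSpace ℂ K] (L : ι → H →ₗ[ℂ] K)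
    (M : ι → K →ₗ[ℂ] H) (hLM : ∀ i v w, inner ℂ (L i v) w = inner ℂ v (M i w)) (ψ : H)
    (hψ : ∑ i, M i (L i ψ) = ψ) : ∑ i, ‖L i ψ‖ ^ 2 = ‖ψ‖ ^ 2 := by
  have h : ((∑ i, ‖L i ψ‖ ^ 2 : ℝ) : ℂ) = ((‖ψ‖ ^ 2 : ℝ) : ℂ) := by
    simp_rw [Complex.ofReal_sum, ← inner_self_eq_ofReal, hLM]
    rw [← inner_sum, hψ]
  exact_mod_cast h

theorem measureZ_ketbra {γ : Type} [Fintype γ] [DecidableEq γ] (ψ : EuclideanSpace ℂ γ ⊗[ℂ] E) :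
    measureZ (ketbra ψ) =
      ∑ z : γ, ketbra ((ketbra (EuclideanSpace.single z (1 : ℂ))).rTensor E ψ) :=
  Finset.sum_congr rfl fun _ _ => comp_ketbra_comp _ _
    (inner_rTensor _ _ fun v w => (isPositive_ketbra _).1 v w) ψ

theorem measureZ_sum_smul {γ ι : Type} [Fintype γ] [DecidableEq γ] (s : Finset ι) (c : ι → ℂ)
    (ρ : ι → (EuclideanSpace ℂ γ ⊗[ℂ] E) →ₗ[ℂ] (EuclideanSpace ℂ γ ⊗[ℂ] E)) :
    measureZ (∑ i ∈ s, c i • ρ i) = ∑ i ∈ s, c i • measureZ (ρ i) := by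
  refine LinearMap.ext fun v => ?_
  simp only [measureZ, LinearMap.sum_apply, LinearMap.comp_apply, LinearMap.smul_apply, map_sum,
    map_smul, Finset.smul_sum]
  exact Finset.sum_comm

/-- Measuring in the computational basis a pure state that is a superposition of `J.card` Fourier
basis vectors yields at least `n log d - log J.card` bits of min-entropy. -/
theorem le_minEntropy_measureZ_ketbra {d : ℕ} [NeZero d] {κ : Type} [Fintype κ] [DecidableEq κ]
    (J : Finset (κ → ZMod d)) (e : (κ → ZMod d) → E)
    (h1 : ‖∑ a ∈ J, stringKet a ⊗ₜ[ℂ] e a‖ = 1) {l : ℝ}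
    (hl : (J.card : ℝ) * ((d : ℝ) ^ Fintype.card κ)⁻¹ ≤ (2 : ℝ) ^ (-l)) :
    (l : EReal) ≤ minEntropy (measureZ (ketbra (∑ a ∈ J, stringKet a ⊗ₜ[ℂ] e a))) := by
  have hnorm : ∑ a ∈ J, ‖e a‖ ^ 2 = 1 := by
    have h : inner ℂ (∑ a ∈ J, stringKet a ⊗ₜ[ℂ] e a) (∑ a ∈ J, stringKet a ⊗ₜ[ℂ] e a) =
        ((∑ a ∈ J, ‖e a‖ ^ 2 : ℝ) : ℂ) := by
      simp only [sum_inner, inner_sum, TensorProduct.inner_tmul,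
        orthonormal_iff_ite.1 orthonormal_stringKet, ite_mul, one_mul, zero_mul]
      rw [Complex.ofReal_sum]
      refine Finset.sum_congr rfl fun a ha => ?_
      simp [ha, inner_self_eq_norm_sq_to_K]
    have h' := (inner_self_eq_ofReal (∑ a ∈ J, stringKet a ⊗ₜ[ℂ] e a)).symm.trans h
    rw [h1, one_pow] at h'
    exact_mod_cast h'.symm
  -- Witness: the marginal on `E` after the superposition over `a` has been dephased in the Fourier
  -- basis. Both operators are then block diagonal in `z`, and the pinching inequality applies to
  -- each block.
  refine le_minEntropy (isDensityOperator_sum_ketbra J e hnorm) ?_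
  rw [lTensor_sum_ketbra, measureZ_ketbra, Finset.smul_sum, ← Finset.sum_sub_distrib]
  refine LinearMap.isPositive_sum _ fun z _ => ?_
  have hz : (ketbra (EuclideanSpace.single z (1 : ℂ))).rTensor E
      (∑ a ∈ J, stringKet a ⊗ₜ[ℂ] e a) =
      ∑ a ∈ J, stringKet a z • EuclideanSpace.single z (1 : ℂ) ⊗ₜ[ℂ] e a := by
    simp only [map_sum, LinearMap.rTensor_tmul, ketbra_apply, EuclideanSpace.inner_single_left,
      map_one, one_mul, TensorProduct.smul_tmul']
  rw [hz]
  refine isPositive_smul_sum_ketbra_sub J (fun a => stringKet a z) _ ?_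
  simpa [normSq_stringKet_apply] using hl

theorem inner_partialBra {α β γ : Type} [Fintype α] [Fintype β] [Fintype γ] (e : α ≃ β × γ)
    (χ : EuclideanSpace ℂ β) (v : EuclideanSpace ℂ α) (w : EuclideanSpace ℂ γ) :
    inner ℂ (partialBra e χ v) w = inner ℂ v (partialKet e χ w) := by
  simp only [PiLp.inner_apply, partialBra, partialKet, LinearMap.coe_mk, AddHom.coe_mk]
  rw [← e.symm.sum_comp, Fintype.sum_prod_type_right]
  simp only [RCLike.inner_apply, map_sum, map_mul, Finset.mul_sum, Equiv.apply_symm_apply]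
  refine Finset.sum_congr rfl fun c _ => Finset.sum_congr rfl fun b _ => ?_
  rw [← Complex.star_def, star_star]
  ring

theorem partialTrace_ketbra {α β γ : Type} [Fintype α] [Fintype β] [Fintype γ] [DecidableEq β]
    (e : α ≃ β × γ) (ψ : EuclideanSpace ℂ α ⊗[ℂ] E) :
    partialTrace e (ketbra ψ) =
      ∑ b, ketbra ((partialBra e (EuclideanSpace.single b (1 : ℂ))).rTensor E ψ) :=
  Finset.sum_congr rfl fun _ _ => comp_ketbra_comp _ _ (inner_rTensor _ _ (inner_partialBra e _)) ψ

theorem partialBra_eq_sum {α β γ : Type} [Fintype α] [Fintype β] [Fintype γ] [DecidableEq β]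
    (e : α ≃ β × γ) (χ : EuclideanSpace ℂ β) :
    partialBra e χ = ∑ b, star (χ b) • partialBra e (EuclideanSpace.single b (1 : ℂ)) := by
  refine LinearMap.ext fun v => ?_
  ext c
  simp [partialBra, apply_ite]

/-- Parseval: `hχ` is the completeness relation `∑ x, |χ x⟩⟨χ x| = id`, tensored with the identity
of `E`. -/
theorem sum_normSq_partialBra {α β γ ι : Type} [Fintype α] [Fintype β] [Fintype γ] [Fintype ι]
    [DecidableEq β] (e : α ≃ β × γ) (χ : ι → EuclideanSpace ℂ β)
    (hχ : ∀ b c, ∑ x, star (χ x b) * χ x c = if b = c then 1 else 0)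
    (ψ : EuclideanSpace ℂ α ⊗[ℂ] E) :
    ∑ x, ‖(partialBra e (χ x)).rTensor E ψ‖ ^ 2 = ‖ψ‖ ^ 2 := by
  have hid : ∑ x, partialKet e (χ x) ∘ₗ partialBra e (χ x) = LinearMap.id := by
    refine LinearMap.ext fun v => ?_
    ext a
    simp only [partialBra, partialKet, LinearMap.sum_apply, LinearMap.comp_apply, LinearMap.coe_mk,
      AddHom.coe_mk, WithLp.ofLp_sum, Finset.sum_apply, LinearMap.id_apply, Finset.mul_sum]
    rw [Finset.sum_comm]
    have : ∀ b, ∑ x, χ x (e a).1 * (star (χ x b) * v (e.symm (b, (e a).2))) =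
        (if b = (e a).1 then 1 else 0) * v (e.symm (b, (e a).2)) := fun b => by
      rw [← hχ, Finset.sum_mul]
      exact Finset.sum_congr rfl fun x _ => by ring
    simp_rw [this]
    simp
  refine sum_normSq_of_sum_comp_eq (fun x => (partialBra e (χ x)).rTensor E)
    (fun x => (partialKet e (χ x)).rTensor E)
    (fun x => inner_rTensor _ _ (inner_partialBra e (χ x))) ψ ?_
  simp only [← LinearMap.comp_apply, ← LinearMap.rTensor_comp]
  rw [← LinearMap.sum_apply]
  simp only [← LinearMap.coe_rTensorHom]
  rw [← map_sum, hid, LinearMap.coe_rTensorHom, LinearMap.rTensor_id, LinearMap.id_apply]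

/-! ### Decomposition of the reduced state into Fourier branches of the Bobs -/

variable {d p : ℕ} [NeZero d] {κ : Type} [Fintype κ] [DecidableEq κ]

theorem bobBranch_eq_sum (ψ : EuclideanSpace ℂ (Word d (p + 1) κ) ⊗[ℂ] E) (x : Word d p κ) :
    bobBranch ψ x = ∑ b, star (fourierKet x b) •
      (partialBra (splitAlice d p κ) (EuclideanSpace.single b (1 : ℂ))).rTensor E ψ := by
  rw [bobBranch, partialBra_eq_sum, ← LinearMap.coe_rTensorHom, map_sum, LinearMap.sum_apply]
  simp only [map_smul, LinearMap.smul_apply, LinearMap.coe_rTensorHom]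

/-- `partialTrace` is defined in the computational basis; the two bases are related by a unitary
matrix, which leaves the sum of the ket-bras unchanged. -/
theorem stateAE_eq_sum_ketbra (ψ : EuclideanSpace ℂ (Word d (p + 1) κ) ⊗[ℂ] E) :
    stateAE ψ = ∑ x, ketbra (bobBranch ψ x) := by
  rw [stateAE, partialTrace_ketbra]
  simp_rw [bobBranch_eq_sum]
  refine (sum_ketbra_of_orthonormal (fun x b => star (fourierKet x b)) (fun b c => ?_) _).symm
  rw [← star_inj, star_sum]
  simp only [star_mul', star_star]
  rw [sum_star_fourierKet_mul']
  split_ifs <;> simp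

theorem sum_normSq_bobBranch (ψ : EuclideanSpace ℂ (Word d (p + 1) κ) ⊗[ℂ] E) :
    ∑ x, ‖bobBranch ψ x‖ ^ 2 = ‖ψ‖ ^ 2 :=
  sum_normSq_partialBra _ _ sum_star_fourierKet_mul' ψ

theorem stateAE_eq_sum_stateAEGiven (ψ : EuclideanSpace ℂ (Word d (p + 1) κ) ⊗[ℂ] E) :
    stateAE ψ = ∑ x, ((‖bobBranch ψ x‖ ^ 2 : ℝ) : ℂ) • stateAEGiven ψ x := by
  rw [stateAE_eq_sum_ketbra]
  exact Finset.sum_congr rfl fun x _ => (normSq_smul_ketbra_unitVec _).symm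

theorem iInf_minEntropy_le_minEntropy_stateAE {ψ : EuclideanSpace ℂ (Word d (p + 1) κ) ⊗[ℂ] E}
    (hψ : ‖ψ‖ = 1) :
    ⨅ x : {x : Word d p κ // bobBranch ψ x ≠ 0}, minEntropy (measureZ (stateAEGiven ψ x.1)) ≤
      minEntropy (measureZ (stateAE ψ)) := by
  classical
  -- Vanishing branches have weight 0, so the mixture may be restricted to the index set of the
  -- infimum.
  have hsupp : ∀ x ∈ (Finset.univ : Finset (Word d p κ)),
      x ∉ Finset.univ.filter (fun x => bobBranch ψ x ≠ 0) → bobBranch ψ x = 0 := by simp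
  have hsum := sum_normSq_bobBranch ψ
  rw [hψ, one_pow, ← Finset.sum_subset (Finset.filter_subset _ _)
    fun x hx hx' => by rw [hsupp x hx hx']; simp] at hsum
  rw [stateAE_eq_sum_stateAEGiven, ← Finset.sum_subset (Finset.filter_subset _ _)
    fun x hx hx' => by rw [hsupp x hx hx']; simp, measureZ_sum_smul]
  refine le_minEntropy_sum_smul _ _ (fun x _ => by positivity) hsum _ _ fun x hx => ?_
  exact iInf_le (fun x : {x : Word d p κ // bobBranch ψ x ≠ 0} =>
    minEntropy (measureZ (stateAEGiven ψ x.1))) ⟨x, (Finset.mem_filter.1 hx).2⟩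

theorem rpow_neg_entropyBound (d : ℕ) (hd : 2 ≤ d) (n : ℕ) (h : ℝ) :
    (2 : ℝ) ^ (-((n : ℝ) * (Real.logb 2 d - h / Real.logb d 2))) =
      (d : ℝ) ^ ((n : ℝ) * h) * ((d : ℝ) ^ n)⁻¹ := by
  have hd1 : (1 : ℝ) < d := by exact_mod_cast hd
  have hd0 : (0 : ℝ) < d := by linarith
  have hl : Real.log d ≠ 0 := (Real.log_pos hd1).ne'
  have hl2 : Real.log 2 ≠ 0 := (Real.log_pos one_lt_two).ne'
  rw [← Real.rpow_natCast, ← Real.rpow_neg hd0.le, ← Real.rpow_add hd0,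
    Real.rpow_def_of_pos two_pos, Real.rpow_def_of_pos hd0]
  congr 1
  simp only [Real.logb]
  field_simp
  ring

theorem le_minEntropy_stateAEGiven [Nonempty κ] (hd : 2 ≤ d) {δ w : ℝ} (hδ : 0 ≤ δ) (hw : 0 ≤ w)
    (hr : w + δ ≤ 1 - 1 / (d : ℝ)) {ψ : EuclideanSpace ℂ (Word d (p + 1) κ) ⊗[ℂ] E}
    (hψ : ψ ∈ fourierSpan E {x | |relWeight (sumWord x) - w| ≤ δ}) (x : Word d p κ)
    (hx : bobBranch ψ x ≠ 0) :
    (((Fintype.card κ : ℝ) * (Real.logb 2 d - dEntropy d (w + δ) / Real.logb d 2) : ℝ) : EReal) ≤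
      minEntropy (measureZ (stateAEGiven ψ x)) := by
  classical
  set J : Finset (κ → ZMod d) := Finset.univ.filter fun a =>
    |relWeight (sumWord (Fin.cons (α := fun _ => κ → ZMod d) a x)) - w| ≤ δ with hJ
  have hmem : unitVec (bobBranch ψ x) ∈ Submodule.span ℂ
      {v | ∃ a ∈ J, ∃ e : E, v = stringKet a ⊗ₜ[ℂ] e} := by
    refine Submodule.smul_mem _ _ ?_
    have h := bobBranch_mem_span hψ x
    simpa [hJ] using h
  obtain ⟨e, he⟩ := exists_eq_sum_tmul J stringKet hmem
  rw [stateAEGiven, he]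
  refine le_minEntropy_measureZ_ketbra J e (he ▸ norm_unitVec hx) ?_
  rw [rpow_neg_entropyBound d hd]
  refine mul_le_mul_of_nonneg_right ?_ (by positivity)
  -- Only the upper half of `|w(s(x)) - w| ≤ δ` is used: it puts `J` in the ball of radius `w + δ`
  -- translated by `-s(x)`.
  refine card_le_of_relWeight_add_le d hd κ (add_nonneg hw hδ) hr (sumWord x) J fun y hy => ?_
  have h := (abs_le.1 (Finset.mem_filter.1 hy).2).2
  have hs : sumWord (Fin.cons (α := fun _ => κ → ZMod d) y x) = y + sumWord x := by
    funext i
    simp [sumWord, Fin.sum_univ_succ]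
  rw [hs] at h
  linarith

end Measured

end QCKA

end

theorem mainTheorem2 {E : Type*} [NormedAddCommGroup E] [InnerProductSpace ℂ E] [CompleteSpace E]
    (d p m n : ℕ) [NeZero d] (hd : 2 ≤ d) (hm : 0 < m) (hn : 0 < n) (δ : ℝ) (hδ : 0 ≤ δ)
    (t : Finset (Fin (m + n))) (ht : t.card = m)
    (φ : EuclideanSpace ℂ (QCKA.Word d (p + 1) (Fin (m + n))) ⊗[ℂ] E)
    (hφ : φ ∈ QCKA.fourierSpan E (QCKA.goodWords t δ)) (hφ_norm : ‖φ‖ = 1)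
    (q : QCKA.Word d (p + 1) {i // i ∈ t}) (hq : QCKA.sampleBranch t q φ ≠ 0)
    (hr : QCKA.relWeight (QCKA.sumWord q) + δ ≤ 1 - 1 / (d : ℝ)) :
    QCKA.collapsed t q φ ∈ QCKA.fourierSpan E
        {x : QCKA.Word d (p + 1) {i // i ∉ t} |
          |QCKA.relWeight (QCKA.sumWord x) - QCKA.relWeight (QCKA.sumWord q)| ≤ δ} ∧
      (((n : ℝ) * (Real.logb 2 d -
          QCKA.dEntropy d (QCKA.relWeight (QCKA.sumWord q) + δ) / Real.logb d 2) : ℝ) : EReal) ≤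
        ⨅ x : {x : QCKA.Word d p {i // i ∉ t} // QCKA.bobBranch (QCKA.collapsed t q φ) x ≠ 0},
          QCKA.minEntropy (QCKA.measureZ (QCKA.stateAEGiven (QCKA.collapsed t q φ) x.1)) ∧
      (⨅ x : {x : QCKA.Word d p {i // i ∉ t} // QCKA.bobBranch (QCKA.collapsed t q φ) x ≠ 0},
          QCKA.minEntropy (QCKA.measureZ (QCKA.stateAEGiven (QCKA.collapsed t q φ) x.1))) ≤
        QCKA.minEntropy (QCKA.measureZ (QCKA.stateAE (QCKA.collapsed t q φ))) := by
  have hmem := QCKA.collapsed_mem_fourierSpan t δ hφ q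
  refine ⟨hmem, le_iInf fun x => ?_,
    QCKA.iInf_minEntropy_le_minEntropy_stateAE (QCKA.norm_unitVec hq)⟩
  have hcard : Fintype.card {i // i ∉ t} = n := by
    rw [Fintype.card_subtype_compl]
    simp [ht]
  have hne : Nonempty {i // i ∉ t} := Fintype.card_pos_iff.1 (hcard.symm ▸ hn)
  have hw : 0 ≤ QCKA.relWeight (QCKA.sumWord q) := div_nonneg (Nat.cast_nonneg _) (Nat.cast_nonneg _)
  have h := QCKA.le_minEntropy_stateAEGiven hd hδ hw hr hmem x.1 x.2
  rwa [hcard] at h
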